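/- Let $\Omega\subset\mathbb R^2$ be the open disk of radius $s>0$ about a point $c$, and let the (complex) admittivity $\gamma$ be a nonzero constant in $\Omega$. Let $p_{k^+},p_{k^-},p_{l^+},p_{l^-}$ be distinct points of $\partial\Omega$ which are met in this order when $\partial\Omega$ is run through once in one of its two orientations, and let $d_1,d_2,d_3>0$, $d_1+d_2+d_3<2\pi s$, be the lengths of the consecutive arcs from $p_{k^+}$ to $p_{k^-}$, from $p_{k^-}$ to $p_{l^+}$ and from $p_{l^+}$ to $p_{l^-}$. Let $I\in\mathbb R\setminus\{0\}$, and consider the point electrode model $$\nabla\cdot(\gamma\nabla u_k)=0\ \text{ in }\Omega,\qquad \gamma\frac{\partial u_k}{\partial n}=I\,(\delta_{p_{k^+}}-\delta_{p_{k^-}})\ \text{ on }\partial\Omega,\qquad \int_{\partial\Omega}u_k\,ds=0,$$ where $u_k:\overline\Omega\to\mathbb C$ is $C^2$ in $\Omega$, continuous on $\overline\Omega\setminus\{p_{k^+},p_{k^-}\}$ and integrable on $\partial\Omega$, and where the boundary condition is understood in the sense of distributions, that is, for every $\varphi\in C^\infty(\mathbb R^2)$, $$\lim_{r\to s^-}\int_{|x-c|=r}\gamma\,\frac{\partial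 u_k}{\partial n}\,\varphi\,ds=I\,\bigl(\varphi(p_{k^+})-\varphi(p_{k^-})\bigr).$$ Then this model has a solution, and for every solution $u_k$ the voltage difference $U_{k,l}:=u_k(p_{l^+})-u_k(p_{l^-})$ is nonzero and $$\gamma=\frac{1}{U_{k,l}}\,\frac{I}{\pi}\,\log\left(\frac{\sin\left(\frac{d_1+d_2+d_3}{2s}\right)\,\sin\left(\frac{d_2}{2s}\right)}{\sin\left(\frac{d_1+d_2}{2s}\right)\,\sin\left(\frac{d_2+d_3}{2s}\right)}\right).$$ -/

import Mathlib

open scoped ContDiff Topology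

noncomputable section

/-- The plane `ℝ²` is modelled by `ℂ` as a real normed space, with coordinate directions `1` and
`Complex.I`. This is the classical operator
`∇·(γ∇u)(x) = ∂₁(γ ∂₁u)(x) + ∂₂(γ ∂₂u)(x)`. -/
def divGrad (γ u : ℂ → ℂ) (x : ℂ) : ℂ :=
  fderiv ℝ (fun y => γ y * fderiv ℝ u y 1) x 1 +
    fderiv ℝ (fun y => γ y * fderiv ℝ u y Complex.I) x Complex.I

/-- The derivative of `u` at `x` in the direction of the outward unit normal, at `x`, of the circle
about `c` through `x`. -/
def normalDeriv (c : ℂ) (u : ℂ → ℂ) (x : ℂ) : ℂ :=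
  fderiv ℝ u x ((x - c) / (‖x - c‖ : ℂ))

/-- The arc length integral `∫ f ds` over the circle of centre `c` and radius `r > 0`. -/
def arcIntegral (f : ℂ → ℂ) (c : ℂ) (r : ℝ) : ℂ :=
  ∫ θ in (0 : ℝ)..(2 * Real.pi), (r : ℂ) * f (circleMap c r θ)

/-- The point electrode model in the disk `Ω = {|x - c| < s}`, for an admittivity `γ` which is
continuously differentiable in `Ω`: the potential `u` satisfies
`∇·(γ∇u) = 0` in `Ω`, `γ ∂u/∂n = I (δ_{p⁺} - δ_{p⁻})` on `∂Ω` and `∫_{∂Ω} u ds = 0`.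

The equation in `Ω` is understood classically. The boundary condition is understood in the sense
of distributions: the fluxes `γ ∂u/∂n` through the interior concentric circles converge to
`I (δ_{p⁺} - δ_{p⁻})` when tested against smooth functions. By the divergence theorem this is
`lim_{r → s} ∫_{|x - c| < r} γ ∇u·∇φ dx = I (φ(p⁺) - φ(p⁻))`, the weak form of the model.
Continuity of `u` up to the boundary away from the two electrodes gives a meaning to the values
`u(p)`, `p ∈ ∂Ω \ {p⁺, p⁻}`. -/
structure IsPointElectrodePotential (c : ℂ) (s : ℝ) (γ : ℂ → ℂ) (I : ℝ) (pPlus pMinus : ℂ)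
    (u : ℂ → ℂ) : Prop where
  contDiffOn : ContDiffOn ℝ 2 u (Metric.ball c s)
  continuousOn : ContinuousOn u (Metric.closedBall c s \ {pPlus, pMinus})
  equation : ∀ x ∈ Metric.ball c s, divGrad γ u x = 0
  flux : ∀ φ : ℂ → ℂ, ContDiff ℝ ∞ φ →
    Filter.Tendsto (fun r : ℝ => arcIntegral (fun x => γ x * normalDeriv c u x * φ x) c r)
      (𝓝[<] s) (𝓝 ((I : ℂ) * (φ pPlus - φ pMinus)))
  integrable_boundary : CircleIntegrable u c s
  integral_boundary : arcIntegral u c s = 0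

/-- The voltage difference `U = u(q⁺) - u(q⁻)` between the measuring electrodes. -/
def voltageDifference (u : ℂ → ℂ) (qPlus qMinus : ℂ) : ℂ := u qPlus - u qMinus

/-- `p₁, p₂, p₃, p₄` are distinct points of the circle of centre `c` and radius `s`, met in this
order when the circle is run through once, in one of its two orientations (`ε = 1` is
counterclockwise, `ε = -1` is clockwise), and the arcs from `p₁` to `p₂`, from `p₂` to `p₃` and
from `p₃` to `p₄` have lengths `d₁`, `d₂` and `d₃`. -/
def HasArcLengths (c : ℂ) (s : ℝ) (p₁ p₂ p₃ p₄ : ℂ) (d₁ d₂ d₃ : ℝ) : Prop :=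
  0 < d₁ ∧ 0 < d₂ ∧ 0 < d₃ ∧ d₁ + d₂ + d₃ < 2 * Real.pi * s ∧
    ∃ θ ε : ℝ, (ε = 1 ∨ ε = -1) ∧
      p₁ = circleMap c s θ ∧
      p₂ = circleMap c s (θ + ε * (d₁ / s)) ∧
      p₃ = circleMap c s (θ + ε * ((d₁ + d₂) / s)) ∧
      p₄ = circleMap c s (θ + ε * ((d₁ + d₂ + d₃) / s))

end

/-! An explicit solution is `I/(πγ₀) · (log|x - q| - log|x - p|)`, where `p`, `q` are the current
electrodes. For `P` on the boundary circle the flux density `Re((x - c)/(x - P)) dθ` of `log|x - P|`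
has mean zero on interior circles and equals `1/2` on the boundary away from `P`, so it converges to
`½ dθ - π δ_P`; the uniform parts cancel in the difference of two logarithms
(`tendsto_integral_re_div_sub_mul`).

Solutions are unique up to a constant off the electrodes. The difference `w` of two solutions is
harmonic, so `∂w/∂z` is holomorphic, and testing the flux against powers of the conjugate of `x - c`
reads off its Taylor coefficients; these vanish because the limiting flux does. The same for the
conjugate of `w` gives `∇w = 0` (`fderiv_eq_zero_of_tendsto_flux`), and continuity carries constancy
to the boundary.

Hence the voltage is that of the explicit potential. Chords have length `2s sin(d/(2s))`, which
gives the formula, and a Ptolemy-type identity shows that the logarithm is nonzero. -/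

/-! ### The logarithmic potential and its harmonicity -/

/-- The potential of a point source at `p` and a point sink at `q`. -/
noncomputable def logPotential (κ p q x : ℂ) : ℂ :=
  κ * ((Real.log ‖x - q‖ - Real.log ‖x - p‖ : ℝ) : ℂ)

lemma hasFDerivAt_log_norm_sub {x p : ℂ} (h : x ≠ p) :
    HasFDerivAt (fun y : ℂ => Real.log ‖y - p‖)
      (Complex.reCLM ∘L ((ContinuousLinearMap.mul ℝ ℂ) (x - p)⁻¹)) x := by
  have hne : x - p ≠ 0 := sub_ne_zero.2 h
  have h1 : HasFDerivAt (fun y : ℂ => ‖y - p‖ ^ 2) _ x :=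
    ((hasFDerivAt_id (𝕜 := ℝ) x).sub_const p).norm_sq
  have h2 := (h1.log (by simpa using hne)).const_mul (1 / 2 : ℝ)
  have h3 : (fun y : ℂ => Real.log ‖y - p‖) = fun y => 1 / 2 * Real.log (‖y - p‖ ^ 2) := by
    funext y
    rw [Real.log_pow]
    push_cast
    ring
  rw [h3]
  refine h2.congr_fderiv ?_
  ext v
  have hn : (‖x - p‖ ^ 2 : ℝ) = Complex.normSq (x - p) := (Complex.normSq_eq_norm_sq _).symm
  have hn0 : Complex.normSq (x - p) ≠ 0 := by simpa [sub_eq_zero] using h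
  simp only [ContinuousLinearMap.comp_apply, smul_apply, hn, Complex.inner,
    innerSL_apply_apply, ContinuousLinearMap.id_apply, Complex.reCLM_apply,
    ContinuousLinearMap.mul_apply', Complex.mul_re, Complex.inv_re, Complex.inv_im,
    Complex.conj_re, Complex.conj_im, smul_eq_mul, nsmul_eq_mul, id]
  push_cast
  field_simp

lemma hasFDerivAt_logPotential {κ p q x : ℂ} (hp : x ≠ p) (hq : x ≠ q) :
    HasFDerivAt (logPotential κ p q)
      (κ • (Complex.ofRealCLM ∘L Complex.reCLM ∘L
        ((ContinuousLinearMap.mul ℝ ℂ) ((x - q)⁻¹ - (x - p)⁻¹)))) x := by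
  have h := (Complex.ofRealCLM.hasFDerivAt.comp x
    ((hasFDerivAt_log_norm_sub hq).sub (hasFDerivAt_log_norm_sub hp))).const_mul κ
  refine h.congr_fderiv ?_
  ext v
  simp

lemma fderiv_logPotential {κ p q x : ℂ} (hp : x ≠ p) (hq : x ≠ q) (v : ℂ) :
    fderiv ℝ (logPotential κ p q) x v = κ * ((((x - q)⁻¹ - (x - p)⁻¹) * v).re : ℂ) := by
  rw [(hasFDerivAt_logPotential hp hq).fderiv]
  rfl

lemma contDiffAt_logPotential {κ p q x : ℂ} (hp : x ≠ p) (hq : x ≠ q) {n : WithTop ℕ∞} :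
    ContDiffAt ℝ n (logPotential κ p q) x := by
  have h (a : ℂ) (ha : x ≠ a) : ContDiffAt ℝ n (fun y : ℂ => Real.log ‖y - a‖) x :=
    ((contDiffAt_id.sub contDiffAt_const).norm ℝ (sub_ne_zero.2 ha)).log
      (by simpa [sub_eq_zero] using ha)
  exact contDiffAt_const.mul (Complex.ofRealCLM.contDiff.contDiffAt.comp x ((h q hq).sub (h p hp)))

/-- The gradient comes from a holomorphic `f`, so the second derivative along `v` is a multiple of
`Re(f'(x) v²)`; the directions `1` and `i` cancel because `i² = -1`. -/
lemma divGrad_logPotential {κ γ₀ p q x : ℂ} {γ : ℂ → ℂ} (hγ : γ =ᶠ[𝓝 x] fun _ => γ₀)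
    (hp : x ≠ p) (hq : x ≠ q) : divGrad γ (logPotential κ p q) x = 0 := by
  have key (v : ℂ) : fderiv ℝ (fun y => γ y * fderiv ℝ (logPotential κ p q) y v) x v =
      γ₀ * (κ * (((-((x - q) ^ 2)⁻¹ + ((x - p) ^ 2)⁻¹) * v * v).re : ℂ)) := by
    have h1 : (fun y => γ y * fderiv ℝ (logPotential κ p q) y v) =ᶠ[𝓝 x]
        fun y => γ₀ * (κ * ((((y - q)⁻¹ - (y - p)⁻¹) * v).re : ℂ)) := by
      filter_upwards [hγ, isOpen_ne.mem_nhds hp, isOpen_ne.mem_nhds hq] with y h hyp hyq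
      rw [h, fderiv_logPotential hyp hyq]
    have h2 (a : ℂ) (ha : x ≠ a) : HasDerivAt (fun y : ℂ => (y - a)⁻¹) (-((x - a) ^ 2)⁻¹) x := by
      have := ((hasDerivAt_id x).sub_const a).inv (sub_ne_zero.2 ha)
      simpa [div_eq_mul_inv] using! this
    have h3 := (((h2 q hq).sub (h2 p hp)).mul_const v).hasFDerivAt.restrictScalars ℝ
    have h4 := ((Complex.ofRealCLM.hasFDerivAt.comp x
      (Complex.reCLM.hasFDerivAt.comp x h3)).const_mul κ).const_mul γ₀
    rw [h1.fderiv_eq]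
    refine (congrArg (fun L : ℂ →L[ℝ] ℂ => L v) (HasFDerivAt.fderiv h4)).trans ?_
    simp
    left; left; ring
  rw [divGrad, key, key]
  have : ∀ z : ℂ, z * Complex.I * Complex.I = -(z * 1 * 1) := fun z => by
    rw [mul_assoc, Complex.I_mul_I]; ring
  rw [this, Complex.neg_re, Complex.ofReal_neg]
  ring

/-! ### Flux of a boundary source, and existence -/

lemma circleMap_ne {c P : ℂ} {s r θ : ℝ} (hP : P ∈ Metric.sphere c s) (hr : r ∈ Set.Ioo 0 s) :
    circleMap c r θ ≠ P := by
  intro h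
  have := circleMap_mem_sphere c hr.1.le θ
  rw [h, Metric.mem_sphere, Metric.mem_sphere.1 hP] at this
  exact hr.2.ne' this

/-- Cauchy's theorem for `1/(z - P)`, with `dz = i (z - c) dθ`. -/
lemma integral_circleMap_div_sub_eq_zero {c P : ℂ} {s r : ℝ} (hP : P ∈ Metric.sphere c s)
    (hr : r ∈ Set.Ioo 0 s) :
    ∫ θ in (0 : ℝ)..2 * Real.pi, (circleMap c r θ - c) / (circleMap c r θ - P) = 0 := by
  have h0 : (∮ z in C(c, r), (z - P)⁻¹) = 0 := by
    refine DiffContOnCl.circleIntegral_eq_zero hr.1.le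
      (DifferentiableOn.diffContOnCl (s := Metric.ball c r) (𝕜 := ℂ) ?_)
    intro z hz
    refine ((differentiableAt_id.sub_const P).inv (sub_ne_zero.2 ?_)).differentiableWithinAt
    rintro rfl
    rw [closure_ball _ hr.1.ne', Metric.mem_closedBall] at hz
    rw [Metric.mem_sphere] at hP
    simp only [id] at hz hP
    linarith [hr.2]
  rw [circleIntegral] at h0
  have h1 : ∀ θ : ℝ, deriv (circleMap c r) θ • (circleMap c r θ - P)⁻¹ =
      Complex.I * ((circleMap c r θ - c) / (circleMap c r θ - P)) := fun θ => by
    simp [div_eq_mul_inv]; ring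
  simp only [h1, intervalIntegral.integral_const_mul] at h0
  simpa using h0

/-- If `|a| = |b|`, expanding gives `|a - b|² = 2 Re(a · conj(a - b))`; take `a = x - c`, `b = P -
c`. -/
lemma re_div_sub_eq_half {c P x : ℂ} {s : ℝ} (hP : P ∈ Metric.sphere c s)
    (hx : x ∈ Metric.sphere c s) (hne : x ≠ P) : ((x - c) / (x - P)).re = 1 / 2 := by
  have hn : Complex.normSq (x - P) ≠ 0 := by simpa [sub_eq_zero] using hne
  have h1 : Complex.normSq (x - c) = Complex.normSq (P - c) := by
    rw [mem_sphere_iff_norm] at hP hx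
    rw [Complex.normSq_eq_norm_sq, Complex.normSq_eq_norm_sq, hP, hx]
  rw [Complex.div_re, ← add_div, div_eq_iff hn]
  simp only [Complex.normSq_apply, Complex.sub_re, Complex.sub_im] at h1 ⊢
  linarith

/-- The kernel blows up near `P`, but its mean is zero for `r < s`, so `φ` may be replaced by `φ - φ
P`. The Lipschitz bound on `φ` then absorbs the singularity and dominated convergence applies. -/
lemma tendsto_integral_re_div_sub_mul {c P : ℂ} {s : ℝ} (hs : 0 < s)
    (hP : P ∈ Metric.sphere c s) {φ : ℂ → ℂ} (hφ : ContDiff ℝ 1 φ) :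
    Filter.Tendsto (fun r : ℝ => ∫ θ in (0 : ℝ)..2 * Real.pi,
        ((((circleMap c r θ - c) / (circleMap c r θ - P)).re : ℝ) : ℂ) * φ (circleMap c r θ))
      (𝓝[<] s)
      (𝓝 ((1 / 2) * (∫ θ in (0 : ℝ)..2 * Real.pi, φ (circleMap c s θ)) - Real.pi * φ P)) := by
  have hIoo : ∀ᶠ r in 𝓝[<] s, r ∈ Set.Ioo 0 s := Ioo_mem_nhdsLT hs
  have hcontφ : Continuous φ := hφ.continuous
  have hcK {r : ℝ} (hr : r ∈ Set.Ioo 0 s) : Continuous fun θ : ℝ =>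
      ((((circleMap c r θ - c) / (circleMap c r θ - P)).re : ℝ) : ℂ) := by
    refine Complex.continuous_ofReal.comp (Complex.continuous_re.comp ?_)
    exact ((continuous_circleMap c r).sub continuous_const).div
      ((continuous_circleMap c r).sub continuous_const)
      fun θ => sub_ne_zero.2 (circleMap_ne hP hr)
  obtain ⟨L, hL⟩ : ∃ L : ℝ, ∀ x ∈ Metric.closedBall c s, ‖φ x - φ P‖ ≤ L * ‖x - P‖ := by
    obtain ⟨L, hL⟩ := (isCompact_closedBall c s).exists_bound_of_continuousOn
      (hφ.continuous_fderiv (by norm_num)).continuousOn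
    refine ⟨L, fun x hx => (convex_closedBall c s).norm_image_sub_le_of_norm_fderiv_le
      (fun y _ => hφ.differentiable (by norm_num) y) hL (Metric.sphere_subset_closedBall hP) hx⟩
  -- The sign of `L` follows from its bound at the point antipodal to `P`.
  have hL0 : 0 ≤ L * s := by
    have h := hL (2 * c - P) (by
      rw [mem_closedBall_iff_norm]; rw [mem_sphere_iff_norm] at hP
      rw [show 2 * c - P - c = -(P - c) by ring, norm_neg, hP])
    rw [show 2 * c - P - P = -(2 * (P - c)) by ring, norm_neg, norm_mul,
      mem_sphere_iff_norm.1 hP] at h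
    have := (norm_nonneg _).trans h
    norm_num at this
    linarith
  have hlim : Filter.Tendsto (fun r : ℝ => ∫ θ in (0 : ℝ)..2 * Real.pi,
        ((((circleMap c r θ - c) / (circleMap c r θ - P)).re : ℝ) : ℂ) *
          (φ (circleMap c r θ) - φ P))
      (𝓝[<] s) (𝓝 (∫ θ in (0 : ℝ)..2 * Real.pi, (1 / 2) * (φ (circleMap c s θ) - φ P))) := by
    refine intervalIntegral.tendsto_integral_filter_of_dominated_convergence (fun _ => L * s)
      ?_ ?_ intervalIntegrable_const ?_
    · filter_upwards [hIoo] with r hr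
      exact ((hcK hr).mul ((hcontφ.comp (continuous_circleMap c r)).sub
        continuous_const)).aestronglyMeasurable
    · filter_upwards [hIoo] with r hr
      refine Filter.Eventually.of_forall fun θ _ => ?_
      have hne : circleMap c r θ ≠ P := circleMap_ne hP hr
      have hpos : 0 < ‖circleMap c r θ - P‖ := norm_pos_iff.2 (sub_ne_zero.2 hne)
      have hxr : ‖circleMap c r θ - c‖ = r := by simp [abs_of_pos hr.1]
      have hx : circleMap c r θ ∈ Metric.closedBall c s := by
        rw [mem_closedBall_iff_norm, hxr]; exact hr.2.le
      rw [norm_mul, Complex.norm_real]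
      calc _ ≤ (r / ‖circleMap c r θ - P‖) * (L * ‖circleMap c r θ - P‖) := by
            refine mul_le_mul ?_ (hL _ hx) (norm_nonneg _) (by have := hr.1; positivity)
            refine (Complex.abs_re_le_norm _).trans ?_
            rw [norm_div, hxr]
        _ = L * r := by field_simp
        _ ≤ L * s := by
            refine mul_le_mul_of_nonneg_left hr.2.le ?_
            exact nonneg_of_mul_nonneg_left hL0 hs
    -- Only countably many angles hit `P`, hence almost none.
    · have hcount := (Set.countable_singleton P).preimage_circleMap c hs.ne'
      filter_upwards [hcount.ae_notMem MeasureTheory.volume] with θ hθ _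
      have hne : circleMap c s θ ≠ P := hθ
      have hc : ContinuousAt (fun r : ℝ => circleMap c r θ) s := by
        unfold circleMap; fun_prop
      have h1 : ContinuousAt (fun r : ℝ =>
          ((((circleMap c r θ - c) / (circleMap c r θ - P)).re : ℝ) : ℂ) *
          (φ (circleMap c r θ) - φ P)) s := by
        refine ContinuousAt.mul ?_ ((hcontφ.continuousAt.comp hc).sub continuousAt_const)
        refine Complex.continuous_ofReal.continuousAt.comp
          (Complex.continuous_re.continuousAt.comp ?_)
        exact (hc.sub continuousAt_const).div (hc.sub continuousAt_const) (sub_ne_zero.2 hne)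
      have h2 := h1.tendsto.mono_left (nhdsWithin_le_nhds (s := Set.Iio s))
      rw [re_div_sub_eq_half hP (circleMap_mem_sphere c hs.le θ) hne] at h2
      simpa using h2
  have hlim2 : (∫ θ in (0 : ℝ)..2 * Real.pi, (1 / 2) * (φ (circleMap c s θ) - φ P)) =
      (1 / 2) * (∫ θ in (0 : ℝ)..2 * Real.pi, φ (circleMap c s θ)) - Real.pi * φ P := by
    have hi : IntervalIntegrable (fun θ => φ (circleMap c s θ)) MeasureTheory.volume
        0 (2 * Real.pi) := (hcontφ.comp (continuous_circleMap c s)).intervalIntegrable _ _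
    rw [intervalIntegral.integral_const_mul,
      intervalIntegral.integral_sub hi intervalIntegrable_const,
      intervalIntegral.integral_const]
    simp
    ring
  rw [← hlim2]
  refine hlim.congr' ?_
  filter_upwards [hIoo] with r hr
  have hK0 : (∫ θ in (0 : ℝ)..2 * Real.pi,
      ((((circleMap c r θ - c) / (circleMap c r θ - P)).re : ℝ) : ℂ)) = 0 := by
    have hci : Continuous fun θ : ℝ => (circleMap c r θ - c) / (circleMap c r θ - P) :=
      ((continuous_circleMap c r).sub continuous_const).div
        ((continuous_circleMap c r).sub continuous_const)
        fun θ => sub_ne_zero.2 (circleMap_ne hP hr)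
    have h := Complex.reCLM.intervalIntegral_comp_comm
      (hci.intervalIntegrable (μ := MeasureTheory.volume) 0 (2 * Real.pi))
    rw [integral_circleMap_div_sub_eq_zero hP hr] at h
    rw [intervalIntegral.integral_ofReal]
    simpa using h
  simp only [mul_sub]
  have hi {ψ : ℝ → ℂ} (hψ : Continuous ψ) : IntervalIntegrable (fun θ : ℝ =>
      ((((circleMap c r θ - c) / (circleMap c r θ - P)).re : ℝ) : ℂ) * ψ θ)
      MeasureTheory.volume 0 (2 * Real.pi) := ((hcK hr).mul hψ).intervalIntegrable _ _
  rw [intervalIntegral.integral_sub (hi (ψ := fun θ => φ (circleMap c r θ)) (hcontφ.comp (continuous_circleMap c r)))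
    (hi (ψ := fun _ => φ P) continuous_const),
    intervalIntegral.integral_mul_const, hK0]
  simp

lemma isPointElectrodePotential_logPotential {c : ℂ} {s : ℝ} (hs : 0 < s) {γ : ℂ → ℂ} {γ₀ : ℂ}
    (hγ₀ : γ₀ ≠ 0) (hγ : ∀ x ∈ Metric.ball c s, γ x = γ₀) (I : ℝ) {p q : ℂ}
    (hp : p ∈ Metric.sphere c s) (hq : q ∈ Metric.sphere c s) :
    IsPointElectrodePotential c s γ I p q (logPotential (I / (Real.pi * γ₀)) p q) := by
  have hne {P x : ℂ} (hP : P ∈ Metric.sphere c s) (hx : x ∈ Metric.ball c s) : x ≠ P := by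
    rintro rfl
    rw [Metric.mem_sphere] at hP
    exact absurd hP (ne_of_lt hx)
  have hpi : (Real.pi : ℂ) ≠ 0 := by exact_mod_cast Real.pi_ne_zero
  have hci (P : ℂ) : IntervalIntegrable (fun θ => Real.log ‖circleMap c s θ - P‖)
      MeasureTheory.volume 0 (2 * Real.pi) :=
    circleIntegrable_log_norm_sub_const (a := P) (c := c) s
  refine ⟨fun x hx => (contDiffAt_logPotential (hne hp hx) (hne hq hx)).contDiffWithinAt,
    fun x hx => ?_, fun x hx => ?_, fun φ hφ => ?_, ?_, ?_⟩
  · simp only [Set.mem_sdiff, Set.mem_insert_iff, Set.mem_singleton_iff, not_or] at hx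
    exact (contDiffAt_logPotential (n := 0) hx.2.1 hx.2.2).continuousAt.continuousWithinAt
  · refine divGrad_logPotential (γ₀ := γ₀) ?_ (hne hp hx) (hne hq hx)
    filter_upwards [Metric.isOpen_ball.mem_nhds hx] with y hy using hγ y hy
  · have hφ1 : ContDiff ℝ 1 φ := hφ.of_le (by exact_mod_cast le_top)
    have h := ((tendsto_integral_re_div_sub_mul hs hq hφ1).sub
      (tendsto_integral_re_div_sub_mul hs hp hφ1)).const_mul ((I : ℂ) / Real.pi)
    have e : ((I : ℂ) / Real.pi) *
        (((1 / 2) * (∫ θ in (0 : ℝ)..2 * Real.pi, φ (circleMap c s θ)) - Real.pi * φ q) -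
        ((1 / 2) * (∫ θ in (0 : ℝ)..2 * Real.pi, φ (circleMap c s θ)) - Real.pi * φ p)) =
        I * (φ p - φ q) := by field_simp; ring
    rw [e] at h
    refine h.congr' ?_
    filter_upwards [Ioo_mem_nhdsLT hs] with r hr
    have hcK {P : ℂ} (hP : P ∈ Metric.sphere c s) : Continuous fun θ : ℝ =>
        ((((circleMap c r θ - c) / (circleMap c r θ - P)).re : ℝ) : ℂ) * φ (circleMap c r θ) := by
      refine (Complex.continuous_ofReal.comp (Complex.continuous_re.comp ?_)).mul
        (hφ.continuous.comp (continuous_circleMap c r))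
      exact ((continuous_circleMap c r).sub continuous_const).div
        ((continuous_circleMap c r).sub continuous_const)
        fun θ => sub_ne_zero.2 (circleMap_ne hP hr)
    rw [← intervalIntegral.integral_sub ((hcK hq).intervalIntegrable _ _)
      ((hcK hp).intervalIntegrable _ _), ← intervalIntegral.integral_const_mul, arcIntegral]
    refine intervalIntegral.integral_congr fun θ _ => ?_
    have hxr : ‖circleMap c r θ - c‖ = r := by simp [abs_of_pos hr.1]
    have hx : circleMap c r θ ∈ Metric.ball c s := by
      rw [mem_ball_iff_norm, hxr]; exact hr.2
    have hr0 : (r : ℂ) ≠ 0 := by exact_mod_cast hr.1.ne'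
    simp only [normalDeriv, fderiv_logPotential (hne hp hx) (hne hq hx), hγ _ hx, hxr]
    rw [mul_div_assoc', Complex.div_ofReal_re, sub_mul, Complex.sub_re, inv_mul_eq_div,
      inv_mul_eq_div]
    push_cast
    field_simp
  · have h := (hci q).sub (hci p)
    exact IntervalIntegrable.const_mul ⟨h.1.ofReal, h.2.ofReal⟩ ((I : ℂ) / (Real.pi * γ₀))
  -- The mean of `log|x - P|` over the circle is `log s` for each `P` on it, so source and sink
  -- cancel.
  · have h1 (P : ℂ) (hP : P ∈ Metric.sphere c s) :
        ∫ θ in (0 : ℝ)..2 * Real.pi, Real.log ‖circleMap c s θ - P‖ =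
          2 * Real.pi * Real.log s := by
      have := circleAverage_log_norm_sub_const_of_mem_closedBall (a := P) (c := c) (R := s)
        (by rw [abs_of_pos hs]; exact Metric.sphere_subset_closedBall hP)
      rw [Real.circleAverage_def] at this
      rw [← this]
      simp only [smul_eq_mul]
      field_simp
    simp only [arcIntegral, logPotential]
    rw [intervalIntegral.integral_const_mul, intervalIntegral.integral_const_mul,
      intervalIntegral.integral_ofReal, intervalIntegral.integral_sub (hci q) (hci p), h1 q hq,
      h1 p hp]
    simp

/-! ### Wirtinger calculus and uniqueness -/

lemma ContDiffAt.differentiableAt_fderiv_apply {u : ℂ → ℂ} {x : ℂ} (hu : ContDiffAt ℝ 2 u x)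
    (v : ℂ) : DifferentiableAt ℝ (fun y => fderiv ℝ u y v) x :=
  ((hu.fderiv_right (m := 1) (by norm_num)).differentiableAt (by norm_num)).clm_apply
    (differentiableAt_const v)

lemma divGrad_of_eventuallyEq_const {γ u : ℂ → ℂ} {γ₀ x : ℂ} (hγ : γ =ᶠ[𝓝 x] fun _ => γ₀)
    (hu : ContDiffAt ℝ 2 u x) : divGrad γ u x = γ₀ * divGrad (fun _ => 1) u x := by
  have key (v : ℂ) : fderiv ℝ (fun y => γ y * fderiv ℝ u y v) x v =
      γ₀ * fderiv ℝ (fun y => 1 * fderiv ℝ u y v) x v := by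
    have h1 : (fun y => γ y * fderiv ℝ u y v) =ᶠ[𝓝 x] fun y => γ₀ * fderiv ℝ u y v := by
      filter_upwards [hγ] with y h
      rw [h]
    rw [h1.fderiv_eq, fderiv_const_mul (hu.differentiableAt_fderiv_apply v)]
    simp
  rw [divGrad, key, key, divGrad, mul_add]

lemma divGrad_one_sub {u v : ℂ → ℂ} {x : ℂ} (hu : ContDiffAt ℝ 2 u x) (hv : ContDiffAt ℝ 2 v x) :
    divGrad (fun _ => 1) (u - v) x = divGrad (fun _ => 1) u x - divGrad (fun _ => 1) v x := by
  have key (w : ℂ) : fderiv ℝ (fun y => 1 * fderiv ℝ (u - v) y w) x w =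
      fderiv ℝ (fun y => 1 * fderiv ℝ u y w) x w - fderiv ℝ (fun y => 1 * fderiv ℝ v y w) x w := by
    have h1 : (fun y => 1 * fderiv ℝ (u - v) y w) =ᶠ[𝓝 x]
        (fun y => fderiv ℝ u y w) - fun y => fderiv ℝ v y w := by
      filter_upwards [hu.eventually (by norm_num), hv.eventually (by norm_num)] with y h1 h2
      rw [fderiv_sub (h1.differentiableAt (by norm_num)) (h2.differentiableAt (by norm_num))]
      simp
    rw [h1.fderiv_eq, fderiv_sub (hu.differentiableAt_fderiv_apply w)
      (hv.differentiableAt_fderiv_apply w)]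
    simp
  rw [divGrad, key, key, divGrad, divGrad]
  ring

lemma fderiv_conj_comp (u : ℂ → ℂ) (x v : ℂ) :
    fderiv ℝ (fun y => (starRingEnd ℂ) (u y)) x v = (starRingEnd ℂ) (fderiv ℝ u x v) := by
  have := Complex.conjCLE.comp_fderiv (f := u) (x := x)
  exact congrArg (fun L : ℂ →L[ℝ] ℂ => L v) this

lemma divGrad_one_conj (u : ℂ → ℂ) (x : ℂ) :
    divGrad (fun _ => 1) (fun y => (starRingEnd ℂ) (u y)) x =
      (starRingEnd ℂ) (divGrad (fun _ => 1) u x) := by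
  simp only [divGrad, one_mul, fderiv_conj_comp, map_add]

/-- The Wirtinger derivative `∂u/∂z`. -/
noncomputable def wirtinger (u : ℂ → ℂ) (x : ℂ) : ℂ :=
  (fderiv ℝ u x 1 - Complex.I * fderiv ℝ u x Complex.I) / 2

/-- The conjugate Wirtinger derivative `∂u/∂z̄`. -/
noncomputable def wirtingerBar (u : ℂ → ℂ) (x : ℂ) : ℂ :=
  (fderiv ℝ u x 1 + Complex.I * fderiv ℝ u x Complex.I) / 2

lemma fderiv_eq_wirtinger (u : ℂ → ℂ) (x v : ℂ) :
    fderiv ℝ u x v = wirtinger u x * v + wirtingerBar u x * (starRingEnd ℂ) v := by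
  have h1 : v = v.re • (1 : ℂ) + v.im • Complex.I := by simp
  have h2 : (starRingEnd ℂ) v = v.re - v.im * Complex.I := by
    apply Complex.ext <;> simp
  have h3 : v = v.re + v.im * Complex.I := (Complex.re_add_im v).symm
  have h4 : fderiv ℝ u x v = v.re * fderiv ℝ u x 1 + v.im * fderiv ℝ u x Complex.I := by
    conv_lhs => rw [h1]
    rw [map_add, map_smul, map_smul]
    simp
  rw [h4, h2]
  conv_rhs => enter [1, 2]; rw [h3]
  rw [wirtinger, wirtingerBar]
  linear_combination (v.im * fderiv ℝ u x Complex.I) * Complex.I_sq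

lemma wirtinger_conj (u : ℂ → ℂ) (x : ℂ) :
    wirtinger (fun y => (starRingEnd ℂ) (u y)) x = (starRingEnd ℂ) (wirtingerBar u x) := by
  simp [wirtinger, wirtingerBar, fderiv_conj_comp, sub_eq_add_neg, Complex.conj_ofNat]

/-- Since `4 ∂/∂z̄ ∂/∂z` is the Laplacian, harmonicity is the Cauchy–Riemann equation for `∂u/∂z`;
symmetry of the second derivative removes the mixed terms. -/
lemma differentiableAt_wirtinger {u : ℂ → ℂ} {x : ℂ} (hu : ContDiffAt ℝ 2 u x)
    (h : divGrad (fun _ => 1) u x = 0) : DifferentiableAt ℂ (wirtinger u) x := by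
  have hD : DifferentiableAt ℝ (fderiv ℝ u) x :=
    (hu.fderiv_right (m := 1) (by norm_num)).differentiableAt (by norm_num)
  have hsymm : IsSymmSndFDerivAt ℝ u x := hu.isSymmSndFDerivAt (by simp)
  have hd (v : ℂ) : HasFDerivAt (fun y => fderiv ℝ u y v)
      ((ContinuousLinearMap.apply ℝ ℂ v) ∘L (fderiv ℝ (fderiv ℝ u) x)) x :=
    (ContinuousLinearMap.apply ℝ ℂ v).hasFDerivAt.comp x hD.hasFDerivAt
  have hw := ((hd 1).sub ((hd Complex.I).const_mul Complex.I)).mul_const (2 : ℂ)⁻¹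
  have hw' : HasFDerivAt (wirtinger u) _ x := hw
  rw [differentiableAt_complex_iff_differentiableAt_real]
  refine ⟨hw'.differentiableAt, ?_⟩
  rw [hw'.fderiv]
  have hs := hsymm 1 Complex.I
  simp only [divGrad, one_mul, (hd _).fderiv] at h
  simp at h hs ⊢
  linear_combination (-(1 / 2) * Complex.I * h) + (1 / 2) * Complex.I ^ 2 * hs +
    (1 / 2) * fderiv ℝ (fderiv ℝ u) x Complex.I 1 * Complex.I_sq

lemma continuousAt_wirtinger {u : ℂ → ℂ} {x : ℂ} (hu : ContDiffAt ℝ 2 u x) :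
    ContinuousAt (wirtinger u) x := by
  have h (v : ℂ) := (hu.differentiableAt_fderiv_apply v).continuousAt
  exact ((h 1).sub (continuousAt_const.mul (h Complex.I))).div_const 2

lemma radius_mul_normalDeriv {c : ℂ} {u : ℂ → ℂ} {r θ : ℝ} (hr : 0 < r) :
    (r : ℂ) * normalDeriv c u (circleMap c r θ) =
      fderiv ℝ u (circleMap c r θ) (circleMap 0 r θ) := by
  have hxr : ‖circleMap c r θ - c‖ = r := by simp [abs_of_pos hr]
  have hr0 : (r : ℂ) ≠ 0 := by exact_mod_cast hr.ne'
  rw [normalDeriv, hxr, fderiv_eq_wirtinger, fderiv_eq_wirtinger, circleMap_sub_center]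
  simp only [map_div₀, Complex.conj_ofReal]
  field_simp

lemma conj_circleMap_zero_eq_div {r θ : ℝ} (hr : 0 < r) :
    (starRingEnd ℂ) (circleMap 0 r θ) = (r : ℂ) ^ 2 / circleMap 0 r θ := by
  have h0 : circleMap 0 r θ ≠ 0 := by simp [circleMap, hr.ne']
  rw [eq_div_iff h0, mul_comm, Complex.mul_conj, Complex.normSq_eq_norm_sq]
  simp

lemma intervalIntegral_conj (f : ℝ → ℂ) (a b : ℝ) :
    ∫ x in a..b, (starRingEnd ℂ) (f x) = (starRingEnd ℂ) (∫ x in a..b, f x) := by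
  simp only [intervalIntegral, integral_conj, map_sub]

/-- With `ζ = x - c`, `r ∂w/∂n = ζ ∂w/∂z + ζ̄ ∂w/∂z̄`. Against `ζ̄^(m+1)` the second term is
antiholomorphic and integrates to zero. In the first, `ζ̄ = r²/ζ` leaves `r^(2(m+1)) ζ^(-m) ∂w/∂z`,
the integrand of the `m`-th Cauchy coefficient. -/
lemma arcIntegral_normalDeriv_mul_conj_pow {c : ℂ} {s r : ℝ} {w : ℂ → ℂ}
    (hw : ∀ x ∈ Metric.ball c s, ContDiffAt ℝ 2 w x)
    (hΔ : ∀ x ∈ Metric.ball c s, divGrad (fun _ => 1) w x = 0) (hr : r ∈ Set.Ioo 0 s) (m : ℕ) :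
    arcIntegral (fun x => normalDeriv c w x * (starRingEnd ℂ) (x - c) ^ (m + 1)) c r =
      2 * Real.pi * (r : ℂ) ^ (2 * (m + 1)) * (cauchyPowerSeries (wirtinger w) c r m fun _ => 1) := by
  have hsub : Metric.closedBall c r ⊆ Metric.ball c s := Metric.closedBall_subset_ball hr.2
  have hmem (θ : ℝ) : circleMap c r θ ∈ Metric.ball c s :=
    hsub (circleMap_mem_closedBall c hr.1.le θ)
  have hc0 (θ : ℝ) : circleMap 0 r θ ≠ 0 := by simp [circleMap, hr.1.ne']
  have hcg : Continuous fun θ : ℝ => wirtinger w (circleMap c r θ) :=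
    continuous_iff_continuousAt.2 fun θ =>
      ContinuousAt.comp (continuousAt_wirtinger (hw _ (hmem θ)))
        (continuous_circleMap c r).continuousAt
  have hwc (x : ℂ) (hx : x ∈ Metric.ball c s) :
      ContDiffAt ℝ 2 (fun y => (starRingEnd ℂ) (w y)) x :=
    Complex.conjCLE.contDiff.contDiffAt.comp x (hw x hx)
  have hk (x : ℂ) : wirtingerBar w x =
      (starRingEnd ℂ) (wirtinger (fun y => (starRingEnd ℂ) (w y)) x) := by
    rw [wirtinger_conj, Complex.conj_conj]
  have hkd (x : ℂ) (hx : x ∈ Metric.ball c s) :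
      DifferentiableAt ℂ (wirtinger (fun y => (starRingEnd ℂ) (w y))) x :=
    differentiableAt_wirtinger (hwc x hx) (by rw [divGrad_one_conj, hΔ x hx, map_zero])
  have hck : Continuous fun θ : ℝ => wirtingerBar w (circleMap c r θ) := by
    simp only [hk]
    exact Complex.continuous_conj.comp (continuous_iff_continuousAt.2 fun θ =>
      ContinuousAt.comp (hkd _ (hmem θ)).continuousAt (continuous_circleMap c r).continuousAt)
  have hcc : Continuous fun θ : ℝ => circleMap 0 r θ := continuous_circleMap 0 r
  have hccc : Continuous fun θ : ℝ => (starRingEnd ℂ) (circleMap 0 r θ) :=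
    Complex.continuous_conj.comp hcc
  have e1 : arcIntegral (fun x => normalDeriv c w x * (starRingEnd ℂ) (x - c) ^ (m + 1)) c r =
      (∫ θ in (0 : ℝ)..2 * Real.pi, wirtinger w (circleMap c r θ) * circleMap 0 r θ *
        (starRingEnd ℂ) (circleMap 0 r θ) ^ (m + 1)) +
      ∫ θ in (0 : ℝ)..2 * Real.pi, wirtingerBar w (circleMap c r θ) *
        (starRingEnd ℂ) (circleMap 0 r θ) ^ (m + 2) := by
    have hi1 : IntervalIntegrable (fun θ => wirtinger w (circleMap c r θ) * circleMap 0 r θ *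
        (starRingEnd ℂ) (circleMap 0 r θ) ^ (m + 1)) MeasureTheory.volume 0 (2 * Real.pi) :=
      ((hcg.mul hcc).mul (hccc.pow _)).intervalIntegrable _ _
    have hi2 : IntervalIntegrable (fun θ => wirtingerBar w (circleMap c r θ) *
        (starRingEnd ℂ) (circleMap 0 r θ) ^ (m + 2)) MeasureTheory.volume 0 (2 * Real.pi) :=
      (hck.mul (hccc.pow _)).intervalIntegrable _ _
    rw [arcIntegral, ← intervalIntegral.integral_add hi1 hi2]
    refine intervalIntegral.integral_congr fun θ _ => ?_
    rw [← mul_assoc, radius_mul_normalDeriv hr.1, fderiv_eq_wirtinger, circleMap_sub_center]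
    ring
  have e2 : (∫ θ in (0 : ℝ)..2 * Real.pi, wirtingerBar w (circleMap c r θ) *
        (starRingEnd ℂ) (circleMap 0 r θ) ^ (m + 2)) = 0 := by
    have h0 : (∮ z in C(c, r), wirtinger (fun y => (starRingEnd ℂ) (w y)) z * (z - c) ^ (m + 1))
        = 0 := by
      refine DiffContOnCl.circleIntegral_eq_zero hr.1.le
        (DifferentiableOn.diffContOnCl (s := Metric.ball c r) (𝕜 := ℂ) fun z hz => ?_)
      rw [closure_ball _ hr.1.ne'] at hz
      exact ((hkd z (hsub hz)).mul
        ((differentiableAt_id.sub_const c).pow _)).differentiableWithinAt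
    -- One of the `m + 2` factors is supplied by `dz = i (z - c) dθ`.
    have h1 : (∮ z in C(c, r), wirtinger (fun y => (starRingEnd ℂ) (w y)) z * (z - c) ^ (m + 1))
        = Complex.I * ∫ θ in (0 : ℝ)..2 * Real.pi, (starRingEnd ℂ)
          (wirtingerBar w (circleMap c r θ) * (starRingEnd ℂ) (circleMap 0 r θ) ^ (m + 2)) := by
      rw [circleIntegral, ← intervalIntegral.integral_const_mul]
      refine intervalIntegral.integral_congr fun θ _ => ?_
      simp [hk, circleMap_sub_center]
      ring
    rw [h0] at h1
    have h2 := (mul_eq_zero.1 h1.symm).resolve_left Complex.I_ne_zero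
    rw [intervalIntegral_conj] at h2
    simpa using h2
  rw [e1, e2, add_zero, cauchyPowerSeries_apply, circleIntegral, smul_eq_mul,
    ← intervalIntegral.integral_const_mul, ← intervalIntegral.integral_const_mul]
  refine intervalIntegral.integral_congr fun θ _ => ?_
  have := hc0 θ
  have hpi : (Real.pi : ℂ) ≠ 0 := by exact_mod_cast Real.pi_ne_zero
  simp only [deriv_circleMap, circleMap_sub_center, conj_circleMap_zero_eq_div hr.1, smul_eq_mul,
    div_pow, one_pow, ← pow_mul, pow_succ (circleMap 0 r θ) m]
  field_simp

/-- The Taylor coefficients at `c` do not depend on the radius, so letting `r → s` in the flux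
identity forces each of them to vanish. -/
lemma wirtinger_eq_zero_of_tendsto_flux {c : ℂ} {s : ℝ} {w : ℂ → ℂ}
    (hw : ∀ x ∈ Metric.ball c s, ContDiffAt ℝ 2 w x)
    (hΔ : ∀ x ∈ Metric.ball c s, divGrad (fun _ => 1) w x = 0)
    (hflux : ∀ φ : ℂ → ℂ, ContDiff ℝ ∞ φ →
      Filter.Tendsto (fun r : ℝ => arcIntegral (fun x => normalDeriv c w x * φ x) c r)
        (𝓝[<] s) (𝓝 0)) {x : ℂ} (hx : x ∈ Metric.ball c s) : wirtinger w x = 0 := by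
  have hs : 0 < s := dist_nonneg.trans_lt hx
  have hd {r : ℝ} (hr : r < s) : DifferentiableOn ℂ (wirtinger w) (Metric.closedBall c r) :=
    fun y hy => (differentiableAt_wirtinger (hw y (Metric.closedBall_subset_ball hr hy))
      (hΔ y (Metric.closedBall_subset_ball hr hy))).differentiableWithinAt
  have hser {r : ℝ} (hr : r ∈ Set.Ioo 0 s) : HasFPowerSeriesOnBall (wirtinger w)
      (cauchyPowerSeries (wirtinger w) c r) c (ENNReal.ofReal r) := by
    lift r to NNReal using hr.1.le
    rw [ENNReal.ofReal_coe_nnreal]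
    exact DifferentiableOn.hasFPowerSeriesOnBall (hd hr.2) (by exact_mod_cast hr.1)
  obtain ⟨ρ, hxρ, hρs⟩ := exists_between (Metric.mem_ball.1 hx)
  have hρ : ρ ∈ Set.Ioo 0 s := ⟨dist_nonneg.trans_lt hxρ, hρs⟩
  have heq {r : ℝ} (hr : r ∈ Set.Ioo 0 s) :
      cauchyPowerSeries (wirtinger w) c r = cauchyPowerSeries (wirtinger w) c ρ :=
    (hser hr).hasFPowerSeriesAt.eq_formalMultilinearSeries (hser hρ).hasFPowerSeriesAt
  have hcoef (m : ℕ) : (cauchyPowerSeries (wirtinger w) c ρ m fun _ => 1) = 0 := by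
    have h1 := hflux (fun x => (starRingEnd ℂ) (x - c) ^ (m + 1))
      ((Complex.conjCLE.contDiff.comp (contDiff_id.sub contDiff_const)).pow _)
    have h2 : Filter.Tendsto (fun r : ℝ => 2 * Real.pi * (r : ℂ) ^ (2 * (m + 1)) *
        (cauchyPowerSeries (wirtinger w) c ρ m fun _ => 1)) (𝓝[<] s) (𝓝 0) := by
      refine h1.congr' ?_
      filter_upwards [Ioo_mem_nhdsLT hs] with r hr
      rw [arcIntegral_normalDeriv_mul_conj_pow hw hΔ hr, heq hr]
    have h3 : Filter.Tendsto (fun r : ℝ => 2 * Real.pi * (r : ℂ) ^ (2 * (m + 1)) *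
        (cauchyPowerSeries (wirtinger w) c ρ m fun _ => 1)) (𝓝[<] s)
        (𝓝 (2 * Real.pi * (s : ℂ) ^ (2 * (m + 1)) *
        (cauchyPowerSeries (wirtinger w) c ρ m fun _ => 1))) := by
      refine Filter.Tendsto.mono_left (Continuous.tendsto ?_ s) nhdsWithin_le_nhds
      fun_prop
    have h4 := tendsto_nhds_unique h3 h2
    have hs0 : (s : ℂ) ≠ 0 := by exact_mod_cast hs.ne'
    have hpi : (Real.pi : ℂ) ≠ 0 := by exact_mod_cast Real.pi_ne_zero
    simpa [hs0, hpi] using h4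
  have hsum := (hser hρ).hasSum (y := x - c) (by
    rw [Metric.mem_eball, edist_dist, dist_zero_right, ← dist_eq_norm]
    exact (ENNReal.ofReal_lt_ofReal_iff hρ.1).2 hxρ)
  have hz : (fun m : ℕ => cauchyPowerSeries (wirtinger w) c ρ m fun _ => x - c) = fun _ => 0 := by
    funext m
    have := (cauchyPowerSeries (wirtinger w) c ρ m).map_smul_univ (fun _ => x - c) (fun _ => 1)
    simpa [hcoef m] using this
  rw [hz, add_sub_cancel] at hsum
  exact hsum.unique hasSum_zero

lemma arcIntegral_conj (f : ℂ → ℂ) (c : ℂ) (r : ℝ) :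
    arcIntegral (fun x => (starRingEnd ℂ) (f x)) c r = (starRingEnd ℂ) (arcIntegral f c r) := by
  simp only [arcIntegral]
  rw [← intervalIntegral_conj]
  simp

/-- The hypotheses are stable under conjugating `w`, as the test functions are complex-valued; this
turns the vanishing of `∂/∂z` into that of `∂/∂z̄`. -/
lemma fderiv_eq_zero_of_tendsto_flux {c : ℂ} {s : ℝ} {w : ℂ → ℂ}
    (hw : ∀ x ∈ Metric.ball c s, ContDiffAt ℝ 2 w x)
    (hΔ : ∀ x ∈ Metric.ball c s, divGrad (fun _ => 1) w x = 0)
    (hflux : ∀ φ : ℂ → ℂ, ContDiff ℝ ∞ φ →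
      Filter.Tendsto (fun r : ℝ => arcIntegral (fun x => normalDeriv c w x * φ x) c r)
        (𝓝[<] s) (𝓝 0)) {x : ℂ} (hx : x ∈ Metric.ball c s) : fderiv ℝ w x = 0 := by
  have h1 := wirtinger_eq_zero_of_tendsto_flux hw hΔ hflux hx
  have h2 : wirtinger (fun y => (starRingEnd ℂ) (w y)) x = 0 := by
    refine wirtinger_eq_zero_of_tendsto_flux (w := fun y => (starRingEnd ℂ) (w y))
      (fun y hy => Complex.conjCLE.contDiff.contDiffAt.comp y (hw y hy))
      (fun y hy => by rw [divGrad_one_conj, hΔ y hy, map_zero]) (fun φ hφ => ?_) hx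
    have h := hflux (fun y => (starRingEnd ℂ) (φ y)) (Complex.conjCLE.contDiff.comp hφ)
    have h' := (Complex.continuous_conj.tendsto 0).comp h
    rw [map_zero] at h'
    refine h'.congr fun r => ?_
    rw [Function.comp_apply, ← arcIntegral_conj]
    simp [normalDeriv, fderiv_conj_comp]
  rw [wirtinger_conj, map_eq_zero] at h2
  ext v
  simp [fderiv_eq_wirtinger, h1, h2]

/-- Two potentials of the point electrode model differ by a constant away from the electrodes. -/
lemma IsPointElectrodePotential.sub_eq_sub {c : ℂ} {s : ℝ} {γ : ℂ → ℂ} {γ₀ : ℂ} (hγ₀ : γ₀ ≠ 0)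
    (hs : 0 < s) (hγ : ∀ x ∈ Metric.ball c s, γ x = γ₀) {I : ℝ} {p q : ℂ} {u v : ℂ → ℂ}
    (hp : p ∈ Metric.sphere c s) (hq : q ∈ Metric.sphere c s)
    (hu : IsPointElectrodePotential c s γ I p q u) (hv : IsPointElectrodePotential c s γ I p q v)
    {x y : ℂ} (hx : x ∈ Metric.closedBall c s \ {p, q}) (hy : y ∈ Metric.closedBall c s \ {p, q}) :
    u x - v x = u y - v y := by
  have hcd {u : ℂ → ℂ} (hu : IsPointElectrodePotential c s γ I p q u) (x : ℂ)
      (hx : x ∈ Metric.ball c s) : ContDiffAt ℝ 2 u x :=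
    hu.contDiffOn.contDiffAt (Metric.isOpen_ball.mem_nhds hx)
  have hΔ {u : ℂ → ℂ} (hu : IsPointElectrodePotential c s γ I p q u) (x : ℂ)
      (hx : x ∈ Metric.ball c s) : divGrad (fun _ => 1) u x = 0 := by
    have h := hu.equation x hx
    rw [divGrad_of_eventuallyEq_const (γ₀ := γ₀) _ (hcd hu x hx)] at h
    · exact (mul_eq_zero.1 h).resolve_left hγ₀
    · filter_upwards [Metric.isOpen_ball.mem_nhds hx] with y hy using hγ y hy
  have hnd {u : ℂ → ℂ} (hu : IsPointElectrodePotential c s γ I p q u) {r : ℝ}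
      (hr : r ∈ Set.Ioo 0 s) {φ : ℂ → ℂ} (hφ : Continuous φ) :
      Continuous fun θ : ℝ => (r : ℂ) * (γ (circleMap c r θ) *
        normalDeriv c u (circleMap c r θ) * φ (circleMap c r θ)) := by
    have hmem (θ : ℝ) : circleMap c r θ ∈ Metric.ball c s :=
      Metric.closedBall_subset_ball hr.2 (circleMap_mem_closedBall c hr.1.le θ)
    have hne (θ : ℝ) : (‖circleMap c r θ - c‖ : ℂ) ≠ 0 := by
      simp [hr.1.ne']
    simp only [fun θ => hγ _ (hmem θ)]
    refine continuous_const.mul ((continuous_const.mul ?_).mul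
      (hφ.comp (continuous_circleMap c r)))
    unfold normalDeriv
    refine Continuous.clm_apply (continuous_iff_continuousAt.2 fun θ => ?_) ?_
    · exact ContinuousAt.comp (((hcd hu _ (hmem θ)).fderiv_right (m := 1)
        (by norm_num)).continuousAt) (continuous_circleMap c r).continuousAt
    · exact ((continuous_circleMap c r).sub continuous_const).div (Complex.continuous_ofReal.comp
        ((continuous_circleMap c r).sub continuous_const).norm) hne
  have hfd : ∀ z ∈ Metric.ball c s, fderiv ℝ (u - v) z = 0 := by
    intro z hz
    refine fderiv_eq_zero_of_tendsto_flux (w := u - v) (fun y hy => (hcd hu y hy).sub (hcd hv y hy))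
      (fun y hy => by rw [divGrad_one_sub (hcd hu y hy) (hcd hv y hy), hΔ hu y hy, hΔ hv y hy,
        sub_zero]) (fun φ hφ => ?_) hz
    have h := ((hu.flux φ hφ).sub (hv.flux φ hφ)).const_mul γ₀⁻¹
    rw [sub_self, mul_zero] at h
    refine h.congr' ?_
    filter_upwards [Ioo_mem_nhdsLT hs] with r hr
    rw [arcIntegral, arcIntegral, arcIntegral, ← intervalIntegral.integral_sub
      ((hnd hu hr hφ.continuous).intervalIntegrable _ _)
      ((hnd hv hr hφ.continuous).intervalIntegrable _ _), ← intervalIntegral.integral_const_mul]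
    refine intervalIntegral.integral_congr fun θ _ => ?_
    have hmem : circleMap c r θ ∈ Metric.ball c s :=
      Metric.closedBall_subset_ball hr.2 (circleMap_mem_closedBall c hr.1.le θ)
    simp only [hγ _ hmem, normalDeriv]
    rw [fderiv_sub ((hcd hu _ hmem).differentiableAt (by norm_num))
      ((hcd hv _ hmem).differentiableAt (by norm_num)), sub_apply]
    field_simp
  have hconst : ∀ z ∈ Metric.ball c s, (u - v) z = (u - v) c := fun z hz =>
    (convex_ball c s).is_const_of_fderivWithin_eq_zero (𝕜 := ℝ)
      (fun y hy => (((hcd hu y hy).sub (hcd hv y hy)).differentiableAt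
        (by norm_num)).differentiableWithinAt)
      (fun y hy => by rw [fderivWithin_of_isOpen Metric.isOpen_ball hy, hfd y hy]) hz
      (Metric.mem_ball_self hs)
  have hball : Metric.ball c s ⊆ Metric.closedBall c s \ {p, q} := fun z hz => by
    refine ⟨Metric.ball_subset_closedBall hz, ?_⟩
    rintro (rfl | rfl)
    · exact absurd hp (ne_of_lt hz)
    · exact absurd hq (ne_of_lt hz)
  -- A boundary point off the electrodes is a limit of interior points, where the difference is
  -- constant.
  have hall : ∀ z ∈ Metric.closedBall c s \ {p, q}, (u - v) z = (u - v) c := by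
    intro z hz
    have hcl : z ∈ closure (Metric.ball c s) := by
      rw [closure_ball _ hs.ne']; exact hz.1
    have h1 : Filter.Tendsto (u - v) (𝓝[Metric.ball c s] z) (𝓝 ((u - v) z)) :=
      ((hu.continuousOn.sub hv.continuousOn) z hz).mono_left (nhdsWithin_mono z hball)
    have h2 : Filter.Tendsto (u - v) (𝓝[Metric.ball c s] z) (𝓝 ((u - v) c)) :=
      tendsto_const_nhds.congr' (by
        filter_upwards [self_mem_nhdsWithin] with y hy using (hconst y hy).symm)
    have := mem_closure_iff_nhdsWithin_neBot.1 hcl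
    exact tendsto_nhds_unique h1 h2
  exact (hall x hx).trans (hall y hy).symm

/-! ### Chord lengths and the voltage formula -/

lemma norm_circleMap_sub_circleMap (c : ℂ) {s : ℝ} (hs : 0 < s) (α β : ℝ) :
    ‖circleMap c s α - circleMap c s β‖ = 2 * s * |Real.sin ((α - β) / 2)| := by
  have h : circleMap c s α - circleMap c s β =
      s * Complex.exp (β * Complex.I) * (Complex.exp (Complex.I * ((α - β : ℝ) : ℂ)) - 1) := by
    rw [mul_sub, mul_assoc, ← Complex.exp_add, circleMap, circleMap, Complex.ofReal_sub]
    ring_nf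
  rw [h, norm_mul, norm_mul, Complex.norm_exp_ofReal_mul_I, Complex.norm_real,
    Complex.norm_exp_I_mul_ofReal_sub_one, Real.norm_eq_abs, Real.norm_eq_abs, abs_mul,
    abs_of_pos hs, abs_two]
  ring

lemma norm_circleMap_sub_circleMap_of_arc (c : ℂ) {s ε α β d : ℝ} (hs : 0 < s)
    (hε : ε = 1 ∨ ε = -1) (hd : α - β = ε * (d / s)) (hd0 : 0 < d) (hd1 : d < 2 * Real.pi * s) :
    0 < Real.sin (d / (2 * s)) ∧
      ‖circleMap c s α - circleMap c s β‖ = 2 * s * Real.sin (d / (2 * s)) := by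
  have hpos : 0 < Real.sin (d / (2 * s)) :=
    Real.sin_pos_of_pos_of_lt_pi (by positivity) (by rw [div_lt_iff₀ (by positivity)]; linarith)
  refine ⟨hpos, ?_⟩
  rw [norm_circleMap_sub_circleMap c hs, hd]
  have e : ε * (d / s) / 2 = ε * (d / (2 * s)) := by field_simp
  rw [e]
  rcases hε with rfl | rfl
  · rw [one_mul, abs_of_pos hpos]
  · rw [neg_one_mul, Real.sin_neg, abs_neg, abs_of_pos hpos]

/-- As in Ptolemy's theorem, `sin(a+b) sin(b+e) - sin(a+b+e) sin b = sin a sin e > 0`, so the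
quotient is not `1`. -/
lemma log_div_sin_ne_zero {a b e : ℝ} (ha : 0 < Real.sin a) (he : 0 < Real.sin e)
    (hb : 0 < Real.sin b) (hab : 0 < Real.sin (a + b)) (hbe : 0 < Real.sin (b + e))
    (habe : 0 < Real.sin (a + b + e)) :
    Real.log (Real.sin (a + b + e) * Real.sin b / (Real.sin (a + b) * Real.sin (b + e))) ≠ 0 := by
  have hne : Real.sin (a + b + e) * Real.sin b / (Real.sin (a + b) * Real.sin (b + e)) ≠ 1 := by
    intro h
    rw [div_eq_one_iff_eq (by positivity)] at h
    have key : Real.sin (a + b) * Real.sin (b + e) - Real.sin (a + b + e) * Real.sin b =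
        Real.sin a * Real.sin e := by
      rw [Real.sin_add (a + b) e, Real.sin_add b e, Real.sin_add a b, Real.cos_add a b]
      linear_combination Real.sin a * Real.sin e * Real.sin_sq_add_cos_sq b
    have := mul_pos ha he
    linarith
  exact Real.log_ne_zero_of_pos_of_ne_one (by positivity) hne

theorem lemma2p2 (c : ℂ) (s : ℝ) (hs : 0 < s)
    (γ : ℂ → ℂ) (γ₀ : ℂ) (hγ₀ : γ₀ ≠ 0) (hγ : ∀ x ∈ Metric.ball c s, γ x = γ₀)
    (I : ℝ) (hI : I ≠ 0)
    (kPlus kMinus lPlus lMinus : ℂ) (d₁ d₂ d₃ : ℝ)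
    (hp : HasArcLengths c s kPlus kMinus lPlus lMinus d₁ d₂ d₃) :
    (∃ u : ℂ → ℂ, IsPointElectrodePotential c s γ I kPlus kMinus u) ∧
    ∀ u : ℂ → ℂ, IsPointElectrodePotential c s γ I kPlus kMinus u →
      voltageDifference u lPlus lMinus ≠ 0 ∧
      γ₀ = 1 / voltageDifference u lPlus lMinus * ((I / Real.pi *
        Real.log ((Real.sin ((d₁ + d₂ + d₃) / (2 * s)) * Real.sin (d₂ / (2 * s))) /
          (Real.sin ((d₁ + d₂) / (2 * s)) * Real.sin ((d₂ + d₃) / (2 * s)))) : ℝ) : ℂ) := by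

  obtain ⟨h1, h2, h3, hsum, θ, ε, hε, rfl, rfl, rfl, rfl⟩ := hp
  have hsph (α : ℝ) : circleMap c s α ∈ Metric.sphere c s := circleMap_mem_sphere c hs.le α
  have hpot := isPointElectrodePotential_logPotential hs hγ₀ hγ I (hsph θ)
    (hsph (θ + ε * (d₁ / s)))
  refine ⟨⟨_, hpot⟩, fun u hu => ?_⟩
  obtain ⟨p12, n12⟩ := norm_circleMap_sub_circleMap_of_arc c (d := d₂) (α := θ + ε * ((d₁ + d₂) / s))
    (β := θ + ε * (d₁ / s)) hs hε (by ring) h2 (by linarith)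
  obtain ⟨p02, n02⟩ := norm_circleMap_sub_circleMap_of_arc c (d := d₁ + d₂)
    (α := θ + ε * ((d₁ + d₂) / s)) (β := θ) hs hε (by ring) (by linarith) (by linarith)
  obtain ⟨p13, n13⟩ := norm_circleMap_sub_circleMap_of_arc c (d := d₂ + d₃)
    (α := θ + ε * ((d₁ + d₂ + d₃) / s)) (β := θ + ε * (d₁ / s)) hs hε (by ring) (by linarith)
    (by linarith)
  obtain ⟨p03, n03⟩ := norm_circleMap_sub_circleMap_of_arc c (d := d₁ + d₂ + d₃)
    (α := θ + ε * ((d₁ + d₂ + d₃) / s)) (β := θ) hs hε (by ring) (by linarith) (by linarith)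
  have p01 := (norm_circleMap_sub_circleMap_of_arc c (d := d₁) (α := θ + ε * (d₁ / s)) (β := θ)
    hs hε (by ring) (by linarith) (by linarith)).1
  -- Only the positivity of the sine is needed, so the arc may start at `θ`.
  have p23 := (norm_circleMap_sub_circleMap_of_arc c (d := d₃) (α := θ + ε * (d₃ / s)) (β := θ)
    hs hε (by ring) (by linarith) (by linarith)).1
  have hne {x y : ℂ} {t : ℝ} (ht : 0 < t) (h : ‖x - y‖ = 2 * s * t) : x ≠ y := by
    rintro rfl
    rw [sub_self, norm_zero] at h
    have : 0 < 2 * s * t := by positivity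
    linarith
  have hU := hu.sub_eq_sub hγ₀ hs hγ (hsph _) (hsph _) hpot
    (x := circleMap c s (θ + ε * ((d₁ + d₂) / s)))
    (y := circleMap c s (θ + ε * ((d₁ + d₂ + d₃) / s)))
    ⟨Metric.sphere_subset_closedBall (hsph _), by simp [hne p02 n02, hne p12 n12]⟩
    ⟨Metric.sphere_subset_closedBall (hsph _), by simp [hne p03 n03, hne p13 n13]⟩
  set ℓ := Real.log ((Real.sin ((d₁ + d₂ + d₃) / (2 * s)) * Real.sin (d₂ / (2 * s))) /
    (Real.sin ((d₁ + d₂) / (2 * s)) * Real.sin ((d₂ + d₃) / (2 * s)))) with hℓ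
  have hℓ0 : ℓ ≠ 0 := by
    have := log_div_sin_ne_zero (a := d₁ / (2 * s)) (b := d₂ / (2 * s)) (e := d₃ / (2 * s))
      p01 p23 p12 (by rwa [← add_div]) (by rwa [← add_div]) (by rwa [← add_div, ← add_div])
    rwa [← add_div, ← add_div, ← add_div] at this
  have hV : voltageDifference u (circleMap c s (θ + ε * ((d₁ + d₂) / s)))
      (circleMap c s (θ + ε * ((d₁ + d₂ + d₃) / s))) = I / (Real.pi * γ₀) * ℓ := by
    have h4 : voltageDifference u (circleMap c s (θ + ε * ((d₁ + d₂) / s)))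
        (circleMap c s (θ + ε * ((d₁ + d₂ + d₃) / s))) = _ :=
      sub_eq_sub_iff_sub_eq_sub.1 hU
    rw [h4, logPotential, logPotential, ← mul_sub, ← Complex.ofReal_sub, n12, n02, n13, n03, hℓ]
    have h2s : 2 * s ≠ 0 := by positivity
    -- After splitting, the four terms `log (2s)` cancel.
    rw [Real.log_div (by positivity) (by positivity), Real.log_mul p03.ne' p12.ne',
      Real.log_mul p02.ne' p13.ne', Real.log_mul h2s p03.ne', Real.log_mul h2s p12.ne',
      Real.log_mul h2s p02.ne', Real.log_mul h2s p13.ne']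
    congr 2
    ring
  have hpi : (Real.pi : ℂ) ≠ 0 := by exact_mod_cast Real.pi_ne_zero
  have hIc : (I : ℂ) ≠ 0 := by exact_mod_cast hI
  have hℓc : (ℓ : ℂ) ≠ 0 := by exact_mod_cast hℓ0
  rw [hV]
  refine ⟨by positivity, ?_⟩
  push_cast
  field_simp
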